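/- For $n\ge 0$ let $E_n(x)\in\mathbb{Q}[x]$ be the Euler polynomial, defined by $$\frac{2e^{xz}}{e^z+1}=\sum_{n\ge 0}E_n(x)\frac{z^n}{n!}.$$ Let $p$ be an odd prime and let $\left(\frac{\cdot}{p}\right)$ be the Legendre symbol. Congruences between rational numbers modulo $p^2$ are understood in the ring $\mathbb{Z}_p$ of $p$-adic integers, that is, both sides lie in $\mathbb{Z}_p$ and their difference lies in $p^2\mathbb{Z}_p$. Then $$\sum_{k=0}^{p-1}\frac{\binom{4k}{2k}}{16^k}\equiv\frac14\left(\frac{2}{p}\right)+\frac34p+\frac{3}{16}\,p\,E_{p-2}\!\left(\frac14\right)\pmod{p^2}.$$ Moreover, if $p>3$, then $$\sum_{k=0}^{p-2}\frac{\binom{4k}{2k}}{(k+1)16^k}\equiv\frac83-\frac23\left(\frac{2}{p}\right)+\frac{10}{3}p-\frac12\,p\,E_{p-2}\!\left(\frac14\right)\pmod{p^2},$$ $$\sum_{k=0}^{p-1}\binom{3k}{k}\left(\frac{4}{27}\right)^k\equiv\frac19+\frac89p+\frac{4}{27}\,p\,E_{p-2}\!\left(\frac13\right)\pmod{p^2},$$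 $$\sum_{k=0}^{p-2}\frac{\binom{3k}{k}}{k+1}\left(\frac{4}{27}\right)^k\equiv 2+\frac52p-\frac13\,p\,E_{p-2}\!\left(\frac13\right)\pmod{p^2},$$ $$\sum_{k=0}^{p-1}\frac{\binom{6k}{3k}\binom{3k}{k}}{108^k\binom{2k}{k}}\equiv\frac49\left(\frac{3}{p}\right)+\frac59p+\frac{5}{27}\,p\,E_{p-2}\!\left(\frac16\right)\pmod{p^2}.$$ If $p>5$, then $$\sum_{k=0}^{p-2}\frac{\binom{6k}{3k}\binom{3k}{k}}{(k+1)108^k\binom{2k}{k}}\equiv\frac{18}{5}-\frac85\left(\frac{3}{p}\right)+\frac{26}{5}p-\frac23\,p\,E_{p-2}\!\left(\frac16\right)\pmod{p^2}.$$ -/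

import Mathlib

/-- The Euler polynomial `E_n(X)`, defined by its exponential generating function
`2 * exp (X z) / (exp z + 1) = ∑ E_n(X) z ^ n / n!`, read in `ℚ[X]⟦z⟧`
(the denominator `exp z + 1` has constant coefficient `2`, so it is invertible in `ℚ⟦z⟧`). -/
noncomputable def eulerPolynomial (n : ℕ) : Polynomial ℚ :=
  (n.factorial : Polynomial ℚ) *
    PowerSeries.coeff n
      (2 * PowerSeries.rescale (Polynomial.X : Polynomial ℚ) (PowerSeries.exp (Polynomial ℚ)) *
        PowerSeries.map Polynomial.C ((PowerSeries.exp ℚ + 1)⁻¹ : PowerSeries ℚ))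

/-- The congruence `a ≡ b (mod p ^ n)` in the ring `ℤ_p` of `p`-adic integers, for rational
numbers `a`, `b`: both are `p`-adic integers and `p ^ n` divides `a - b` in `ℤ_p`. -/
def PadicIntCongr (p : ℕ) [Fact p.Prime] (n : ℕ) (a b : ℚ) : Prop :=
  ∃ u v : ℤ_[p], (u : ℚ_[p]) = (a : ℚ_[p]) ∧ (v : ℚ_[p]) = (b : ℚ_[p]) ∧
    (p : ℤ_[p]) ^ n ∣ u - v

set_option linter.unusedSectionVars false

open Finset

/-! For r = 1/4, 1/3, 1/6 the summands are the terms (r)_k(1-r)_k/((1/2)_k k!) of ₂F₁(-a, a+1; 1/2;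
1) with a = -r, so all six congruences follow from the truncated sum S(a) of p terms modulo p². Up
to the symmetry a ↔ -1-a, one may write a = m + pt with t = -r and 2m < p.

At a = pt, S is 1 + ct + dt² modulo p² with c, d independent of t (`exists_hypSum_approx`). The
exact values at t = 1 and t = -1 determine c and d (`hypSum_self_mul_powDvd`). A contiguous relation
(`hypSum_recurrence`) links S(a) and S(a-1) through the last term, which Wilson's theorem evaluates
modulo p² (`hypTerm_pred_powDvd`). Iterating from pt to m + pt produces the alternating harmonic sum
∑_{j≤m} (-1)^j/j (`hypSum_powDvd_altHarmonic`).

Modulo p this harmonic sum is expressed by E_{p-2}(m+1) and E_{p-2}(0), and the E_{p-2}(0) part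
cancels the Fermat quotient of 4 (`hypSum_powDvd_euler`). Since m+1 ≡ 1-r or r, the reflection
formula leaves E_{p-2}(r). The sums with k+1 in the denominator reduce to S by a telescoping
identity (`sum_hypTerm_div`). -/

/-! ### Divisibility of rationals in the localization of ℤ at p. -/

/-- `p ^ n` divides the rational number `x` in the localization of `ℤ` at `p`. -/
def PowDvd (p n : ℕ) (x : ℚ) : Prop := padicNorm p x ≤ (p : ℚ) ^ (-(n : ℤ))

/-- The rational number `x` is a unit in the localization of `ℤ` at `p`. -/
def IsPUnit (p : ℕ) (x : ℚ) : Prop := padicNorm p x = 1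

namespace PowDvd

variable {p : ℕ} [hp : Fact p.Prime] {n m : ℕ} {x y x' y' : ℚ}

theorem zero_iff : PowDvd p 0 x ↔ padicNorm p x ≤ 1 := by simp [PowDvd]

theorem nat (z : ℕ) : PowDvd p 0 z := zero_iff.2 (padicNorm.of_nat z)

theorem one : PowDvd p 0 1 := by simpa using nat (p := p) 1

theorem two : PowDvd p 0 2 := by simpa using nat (p := p) 2

theorem four : PowDvd p 0 4 := by simpa using nat (p := p) 4

theorem zero : PowDvd p n 0 := by simp only [PowDvd, padicNorm.zero]; positivity

theorem self : PowDvd p 1 p := by simp [PowDvd]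

theorem add (hx : PowDvd p n x) (hy : PowDvd p n y) : PowDvd p n (x + y) :=
  padicNorm.nonarchimedean.trans (max_le hx hy)

theorem neg (hx : PowDvd p n x) : PowDvd p n (-x) := by
  simpa only [PowDvd, padicNorm.neg] using hx

theorem sub (hx : PowDvd p n x) (hy : PowDvd p n y) : PowDvd p n (x - y) := by
  simpa only [sub_eq_add_neg] using hx.add hy.neg

theorem mul (hx : PowDvd p n x) (hy : PowDvd p m y) : PowDvd p (n + m) (x * y) := by
  have hp0 : (p : ℚ) ≠ 0 := by exact_mod_cast hp.out.ne_zero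
  have : (p : ℚ) ^ (-((n + m : ℕ) : ℤ)) = (p : ℚ) ^ (-(n : ℤ)) * (p : ℚ) ^ (-(m : ℤ)) := by
    rw [← zpow_add₀ hp0]; congr 1; push_cast; ring
  simp only [PowDvd, padicNorm.mul, this] at *
  exact mul_le_mul hx hy (padicNorm.nonneg _) (by positivity)

theorem mul_left (hx : PowDvd p n x) (hy : PowDvd p 0 y) : PowDvd p n (y * x) := by
  simpa using hy.mul hx

theorem mul_right (hx : PowDvd p n x) (hy : PowDvd p 0 y) : PowDvd p n (x * y) := by
  simpa using hx.mul hy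

theorem pow (hx : PowDvd p 0 x) (k : ℕ) : PowDvd p 0 (x ^ k) := by
  induction k with
  | zero => simpa using one
  | succ k ih => rw [pow_succ]; exact ih.mul hx

theorem mono (h : m ≤ n) (hx : PowDvd p n x) : PowDvd p m x :=
  le_trans hx (zpow_le_zpow_right₀ (by exact_mod_cast hp.out.one_le) (by omega))

theorem sum {ι : Type*} {s : Finset ι} {f : ι → ℚ} (h : ∀ i ∈ s, PowDvd p n (f i)) :
    PowDvd p n (∑ i ∈ s, f i) :=
  padicNorm.sum_le' h (by positivity)

theorem div (hx : PowDvd p n x) (hy : IsPUnit p y) : PowDvd p n (x / y) := by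
  simp only [PowDvd, IsPUnit, padicNorm.div] at *
  rwa [hy, div_one]

theorem int_iff {z : ℤ} : PowDvd p n z ↔ (p : ℤ) ^ n ∣ z := by
  rw [PowDvd, ← padicNorm.dvd_iff_norm_le]; push_cast; rfl

theorem mul_sub_mul (hx : PowDvd p n (x - x')) (hy : PowDvd p n (y - y')) (hx' : PowDvd p 0 x')
    (hy0 : PowDvd p 0 y) : PowDvd p n (x * y - x' * y') := by
  have := (hx.mul_right hy0).add (hy.mul_left hx')
  convert this using 1; ring

theorem prod {ι : Type*} {s : Finset ι} {f : ι → ℚ} (h : ∀ i ∈ s, PowDvd p 0 (f i)) :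
    PowDvd p 0 (∏ i ∈ s, f i) := by
  classical
  induction s using Finset.induction_on with
  | empty => simpa using one
  | insert a s ha ih =>
    rw [Finset.prod_insert ha]
    exact (h a (by simp)).mul (ih fun i hi => h i (by simp [hi]))

theorem prod_sub_prod {ι : Type*} {s : Finset ι} {f g : ι → ℚ}
    (h : ∀ i ∈ s, PowDvd p n (f i - g i)) (hf : ∀ i ∈ s, PowDvd p 0 (f i))
    (hg : ∀ i ∈ s, PowDvd p 0 (g i)) :
    PowDvd p n (∏ i ∈ s, f i - ∏ i ∈ s, g i) := by
  classical
  induction s using Finset.induction_on with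
  | empty => simpa using zero
  | insert a s ha ih =>
    rw [Finset.prod_insert ha, Finset.prod_insert ha]
    exact mul_sub_mul (h a (by simp))
      (ih (fun i hi => h i (by simp [hi])) (fun i hi => hf i (by simp [hi]))
        fun i hi => hg i (by simp [hi])) (hg a (by simp))
      (prod fun i hi => hf i (by simp [hi]))

theorem padicIntCongr (h : PowDvd p n (x - y)) (hy : PowDvd p 0 y) : PadicIntCongr p n x y := by
  have hx : PowDvd p 0 x := by simpa using (h.mono (Nat.zero_le n)).add hy
  have key : ∀ z : ℚ, PowDvd p 0 z → ‖(z : ℚ_[p])‖ ≤ 1 := fun z hz => by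
    rw [Padic.eq_padicNorm]; exact_mod_cast zero_iff.1 hz
  refine ⟨⟨x, key x hx⟩, ⟨y, key y hy⟩, rfl, rfl, ?_⟩
  rw [← Ideal.mem_span_singleton, ← PadicInt.norm_le_pow_iff_mem_span_pow]
  change ‖(x : ℚ_[p]) - (y : ℚ_[p])‖ ≤ _
  rw [← Rat.cast_sub, Padic.eq_padicNorm]
  exact (Rat.cast_le.2 h).trans_eq (by push_cast; rfl)

end PowDvd

namespace IsPUnit

variable {p : ℕ} [hp : Fact p.Prime] {x y : ℚ}

theorem ne_zero (h : IsPUnit p x) : x ≠ 0 := by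
  rintro rfl
  simp [IsPUnit] at h

theorem powDvd (h : IsPUnit p x) : PowDvd p 0 x := PowDvd.zero_iff.2 h.le

theorem mul (hx : IsPUnit p x) (hy : IsPUnit p y) : IsPUnit p (x * y) := by
  simp only [IsPUnit, padicNorm.mul] at *
  rw [hx, hy, one_mul]

theorem neg (hx : IsPUnit p x) : IsPUnit p (-x) := by
  simpa only [IsPUnit, padicNorm.neg] using hx

theorem div (hx : IsPUnit p x) (hy : IsPUnit p y) : IsPUnit p (x / y) := by
  simp only [IsPUnit, padicNorm.div] at *
  rw [hx, hy, one_div_one]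

theorem nat_iff {z : ℕ} : IsPUnit p z ↔ ¬ p ∣ z := padicNorm.nat_eq_one_iff z

theorem one : IsPUnit p 1 := by simp [IsPUnit]

theorem of_prime {q : ℕ} (hq : q.Prime) (h : p ≠ q) : IsPUnit p q :=
  nat_iff.2 fun hd => h ((Nat.prime_dvd_prime_iff_eq hp.out hq).1 hd)

theorem of_sub (h : PowDvd p 1 (x - y)) (hy : IsPUnit p y) : IsPUnit p x := by
  have h1 : padicNorm p (x - y) < 1 := by
    refine lt_of_le_of_lt h ?_
    have : (1 : ℚ) < p := by exact_mod_cast hp.out.one_lt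
    simpa using inv_lt_one_of_one_lt₀ this
  have hne : padicNorm p (x - y) ≠ padicNorm p y := by
    rw [show padicNorm p y = 1 from hy]; exact h1.ne
  have := padicNorm.add_eq_max_of_ne hne
  rw [sub_add_cancel, show padicNorm p y = 1 from hy, max_eq_right h1.le] at this
  exact this

end IsPUnit

theorem PowDvd.of_mul {p : ℕ} [Fact p.Prime] {n : ℕ} {x u : ℚ} (hu : IsPUnit p u)
    (h : PowDvd p n (u * x)) : PowDvd p n x := by
  have := h.div hu
  rwa [mul_div_cancel_left₀ _ hu.ne_zero] at this

theorem PowDvd.of_self_mul {p : ℕ} [hp : Fact p.Prime] {n : ℕ} {x : ℚ}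
    (h : PowDvd p (n + 1) (p * x)) : PowDvd p n x := by
  have hp0 : (0 : ℚ) < p := by exact_mod_cast hp.out.pos
  have e : (p : ℚ) ^ (-((n + 1 : ℕ) : ℤ)) = (p : ℚ)⁻¹ * (p : ℚ) ^ (-(n : ℤ)) := by
    rw [← zpow_neg_one, ← zpow_add₀ hp0.ne']; congr 1; push_cast; ring
  rw [PowDvd, padicNorm.mul, e, padicNorm.padicNorm_p_of_prime] at h
  exact le_of_mul_le_mul_left h (by positivity)

/-! ### The truncated ₂F₁ series: contiguous relation and exact values. -/

/-- The `k`-th term `(-a)_k (a+1)_k / ((1/2)_k k!)` of the hypergeometric series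
`₂F₁(-a, a+1; 1/2; 1)`. -/
def hypTerm (a : ℚ) (k : ℕ) : ℚ :=
  ∏ i ∈ range k, (i - a) * (i + 1 + a) / ((i + 1 / 2) * (i + 1))

/-- The sum of the first `n` terms of `₂F₁(-a, a+1; 1/2; 1)`. -/
def hypSum (a : ℚ) (n : ℕ) : ℚ := ∑ k ∈ range n, hypTerm a k

/-- The product `(-a)_n = (-a)(1-a)⋯(n-1-a)`. -/
def negRising (a : ℚ) (n : ℕ) : ℚ := ∏ i ∈ range n, ((i : ℚ) - a)

theorem hypTerm_zero (a : ℚ) : hypTerm a 0 = 1 := by simp [hypTerm]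

theorem hypTerm_succ (a : ℚ) (k : ℕ) :
    hypTerm a (k + 1) = hypTerm a k * ((k - a) * (k + 1 + a) / ((k + 1 / 2) * (k + 1))) :=
  prod_range_succ _ _

theorem hypTerm_symm (a : ℚ) (k : ℕ) : hypTerm (-1 - a) k = hypTerm a k := by
  refine prod_congr rfl fun i _ => ?_
  congr 1; ring

theorem hypSum_symm (a : ℚ) (n : ℕ) : hypSum (-1 - a) n = hypSum a n :=
  sum_congr rfl fun i _ => hypTerm_symm a i

theorem hypTerm_eq (a : ℚ) (k : ℕ) :
    hypTerm a k = negRising a k * negRising (-1 - a) k / (negRising (-1 / 2) k * k.factorial) := by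
  induction k with
  | zero => simp [hypTerm, negRising]
  | succ k ih =>
    rw [hypTerm_succ, ih]
    simp only [negRising, prod_range_succ, Nat.factorial_succ]
    push_cast
    rw [div_mul_div_comm]
    congr 1 <;> ring

/-- Lowering a shifts both rising factorials by one place; the factors a and -a that appear cancel,
so no a ≠ 0 is needed. -/
theorem hypTerm_sub_one (a : ℚ) (n : ℕ) :
    hypTerm (a - 1) (n + 1) =
      -hypTerm a n * ((n - a) * (n + 1 - a) / ((n + 1 / 2) * (n + 1))) := by
  induction n with
  | zero => simp [hypTerm]; ring
  | succ n ih =>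
    rw [hypTerm_succ, ih, hypTerm_succ]
    have h1 : (n : ℚ) + 1 ≠ 0 := by positivity
    have h2 : (n : ℚ) + 1 / 2 ≠ 0 := by positivity
    have h3 : (n : ℚ) + 1 + 1 ≠ 0 := by positivity
    have h4 : (n : ℚ) + 1 + 1 / 2 ≠ 0 := by positivity
    push_cast
    field_simp
    ring

/-- A contiguous relation by telescoping: the same combination of single terms is the increment of
the right-hand side. It moves a by one at the cost of the last term. -/
theorem hypSum_recurrence (a : ℚ) (n : ℕ) :
    (2 * a - 1) * hypSum a (n + 1) + (2 * a + 1) * hypSum (a - 1) (n + 1) =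
      -4 * hypTerm a n * (n - a) := by
  induction n with
  | zero => simp [hypSum, hypTerm]; ring
  | succ n ih =>
    have e : ∀ b, hypSum b (n + 1 + 1) = hypSum b (n + 1) + hypTerm b (n + 1) :=
      fun b => sum_range_succ _ _
    rw [e, e, hypTerm_sub_one, hypTerm_succ]
    have h1 : (n : ℚ) + 1 ≠ 0 := by positivity
    have h2 : (2 * n : ℚ) + 1 ≠ 0 := by positivity
    have h3 : (n : ℚ) + 1 / 2 = (2 * n + 1) / 2 := by ring
    rw [h3]
    have : (2 * a - 1) * hypSum a (n + 1) =
      -4 * hypTerm a n * (n - a) - (2 * a + 1) * hypSum (a - 1) (n + 1) := by linarith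
    rw [mul_add, this]
    push_cast
    field_simp
    ring

theorem sum_hypTerm_div (a : ℚ) (n : ℕ) :
    a * (a + 1) * ∑ k ∈ range n, hypTerm a k / (k + 1) =
      1 / 2 * hypSum a n - 1 / 2 - (n - 1 / 2) * hypTerm a n := by
  induction n with
  | zero => simp [hypSum, hypTerm]
  | succ n ih =>
    rw [sum_range_succ, mul_add, ih, hypSum, hypSum, sum_range_succ, hypTerm_succ]
    have h1 : (n : ℚ) + 1 ≠ 0 := by positivity
    have h2 : (2 * n : ℚ) + 1 ≠ 0 := by positivity
    have h3 : (n : ℚ) + 1 / 2 = (2 * n + 1) / 2 := by ring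
    rw [h3]
    push_cast
    field_simp
    ring

theorem negRising_natCast {m n : ℕ} (h : m < n) : negRising m n = 0 :=
  prod_eq_zero (mem_range.2 h) (sub_self _)

theorem hypTerm_natCast {m n : ℕ} (h : m < n) : hypTerm m n = 0 := by
  rw [hypTerm_eq, negRising_natCast h]; simp

/-- The series has terminated, so the boundary term of the recurrence vanishes. -/
theorem hypSum_natCast {m n : ℕ} (h : m < n) : hypSum m n = (-1) ^ m * (2 * m + 1) := by
  obtain ⟨n, rfl⟩ : ∃ k, n = k + 1 := ⟨n - 1, by omega⟩
  induction m with
  | zero =>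
    rw [hypSum, sum_range_succ', sum_eq_zero fun i _ => ?_]
    · simp [hypTerm]
    · exact hypTerm_natCast (Nat.succ_pos i)
  | succ m ih =>
    have hr := hypSum_recurrence (m + 1 : ℕ) n
    have hz : hypTerm (m + 1 : ℕ) n * (n - (m + 1 : ℕ)) = 0 := by
      rcases (Nat.lt_succ_iff.1 h).eq_or_lt with h' | h'
      · rw [h', sub_self, mul_zero]
      · rw [hypTerm_natCast h', zero_mul]
    rw [mul_assoc, hz, mul_zero] at hr
    have e : ((m + 1 : ℕ) : ℚ) - 1 = m := by push_cast; ring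
    rw [e, ih (by omega)] at hr
    have h2 : (2 * (m + 1 : ℕ) - 1 : ℚ) ≠ 0 := by
      have : (2 * (m + 1 : ℕ) - 1 : ℚ) = 2 * m + 1 := by push_cast; ring
      rw [this]; positivity
    apply mul_left_cancel₀ h2
    push_cast at hr ⊢
    linear_combination hr

theorem hypTerm_succ_self (n : ℕ) : hypTerm (n + 1 : ℕ) n = (-1) ^ n * (2 * n + 1) * 4 ^ n := by
  -- At a = n+1 the k-th term is (-4)^k C(n+1+k, 2k).
  have h : ∀ k ≤ n, hypTerm (n + 1 : ℕ) k =
      (-1) ^ k * 4 ^ k * ((n + 1 + k).factorial / ((n + 1 - k).factorial * (2 * k).factorial)) := by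
    intro k hk
    induction k with
    | zero =>
      have := Nat.factorial_ne_zero (n + 1)
      simp [hypTerm]; field_simp
    | succ k ih =>
      obtain ⟨d, rfl⟩ : ∃ d, n = k + 1 + d := ⟨n - (k + 1), by omega⟩
      rw [hypTerm_succ, ih (by omega)]
      have e1 : k + 1 + d + 1 - k = (d + 1) + 1 := by omega
      have e2 : k + 1 + d + 1 - (k + 1) = d + 1 := by omega
      have e3 : k + 1 + d + 1 + (k + 1) = (k + 1 + d + 1 + k) + 1 := by omega
      have e4 : 2 * (k + 1) = (2 * k + 1) + 1 := by omega
      rw [e1, e2, e3, e4, Nat.factorial_succ (d + 1), Nat.factorial_succ (k + 1 + d + 1 + k),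
        Nat.factorial_succ (2 * k + 1), Nat.factorial_succ (2 * k)]
      have f1 := Nat.factorial_ne_zero (d + 1)
      have f2 := Nat.factorial_ne_zero (2 * k)
      have h1 : (k : ℚ) + 1 ≠ 0 := by positivity
      have h2 : (2 * k : ℚ) + 1 ≠ 0 := by positivity
      have h3 : (k : ℚ) + 1 / 2 = (2 * k + 1) / 2 := by ring
      have h4 : (2 * k : ℚ) + 1 + 1 = 2 * (k + 1) := by ring
      have h5 : (d : ℚ) + 1 + 1 ≠ 0 := by positivity
      push_cast
      rw [h3, h4]
      field_simp
      ring
  rw [h n le_rfl]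
  have e1 : n + 1 - n = 1 := by omega
  have e2 : n + 1 + n = 2 * n + 1 := by omega
  rw [e1, e2, Nat.factorial_succ]
  have := Nat.factorial_ne_zero (2 * n)
  push_cast
  field_simp
  simp

/-- Here the series is cut one term before it ends, so the boundary term survives and brings the
power of 4. With n + 1 = p, this and `hypSum_neg` are the values at a = p and a = -p. -/
theorem hypSum_self {n : ℕ} (hn : Even n) :
    hypSum (n + 1 : ℕ) (n + 1) = 4 ^ (n + 1) - 2 * n - 3 := by
  have hr := hypSum_recurrence (n + 1 : ℕ) n
  have e : ((n + 1 : ℕ) : ℚ) - 1 = n := by push_cast; ring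
  rw [e, hypSum_natCast (Nat.lt_succ_self n), hypTerm_succ_self, hn.neg_one_pow] at hr
  have h2 : (2 * n + 1 : ℚ) ≠ 0 := by positivity
  apply mul_left_cancel₀ h2
  rw [pow_succ]
  push_cast at hr ⊢
  linear_combination hr

theorem hypSum_neg {n : ℕ} (hn : Even n) :
    hypSum (-(n + 1 : ℕ)) (n + 1) = 2 * n + 1 := by
  have := hypSum_symm n (n + 1)
  rw [hypSum_natCast (Nat.lt_succ_self n), hn.neg_one_pow, one_mul] at this
  rw [← this]; congr 1; push_cast; ring

/-! ### The last term of the truncated series modulo p². -/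

section

variable {p : ℕ} [hp : Fact p.Prime]

theorem prod_erase_sub_eq_neg_one {m : ℕ} (hm : m < p) :
    ∏ i ∈ (range p).erase m, ((i : ZMod p) - m) = -1 := by
  have h1 : ∏ i ∈ (range p).erase m, ((i : ZMod p) - m) =
      ∏ x ∈ (univ : Finset (ZMod p)).erase 0, x := by
    refine prod_bij (fun i _ => (i : ZMod p) - m) ?_ ?_ ?_ ?_
    · intro i hi
      simp only [mem_erase, mem_range, mem_univ, and_true] at hi ⊢
      rw [sub_ne_zero, Ne, ZMod.natCast_eq_natCast_iff']
      rw [Nat.mod_eq_of_lt hi.2, Nat.mod_eq_of_lt hm]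
      exact hi.1
    · intro i hi j hj h
      simp only [mem_erase, mem_range] at hi hj
      have h := sub_left_inj.1 h
      rw [ZMod.natCast_eq_natCast_iff', Nat.mod_eq_of_lt hi.2, Nat.mod_eq_of_lt hj.2] at h
      exact h
    · intro x hx
      refine ⟨(x + m).val, ?_, by simp⟩
      simp only [mem_erase, mem_range, mem_univ, and_true] at hx ⊢
      refine ⟨fun h => hx ?_, ZMod.val_lt _⟩
      have : ((x + m).val : ZMod p) = m := by rw [h]
      simpa using this
    · intro i _; rfl
  have h2 : ∏ x ∈ Ico 1 p, (x : ZMod p) = ∏ x ∈ (univ : Finset (ZMod p)).erase 0, x := by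
    refine prod_bij (fun i _ => (i : ZMod p)) ?_ ?_ ?_ ?_
    · intro i hi
      simp only [mem_Ico, mem_erase, mem_univ, and_true] at hi ⊢
      rw [Ne, ZMod.natCast_eq_zero_iff]
      exact fun h => absurd (Nat.le_of_dvd (by omega) h) (by omega)
    · intro i hi j hj h
      simp only [mem_Ico] at hi hj
      rw [ZMod.natCast_eq_natCast_iff', Nat.mod_eq_of_lt hi.2, Nat.mod_eq_of_lt hj.2] at h
      exact h
    · intro x hx
      simp only [mem_erase, mem_univ, and_true] at hx
      refine ⟨x.val, ?_, by simp⟩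
      rw [mem_Ico]
      exact ⟨Nat.pos_of_ne_zero (by simpa using hx), ZMod.val_lt _⟩
    · intro i _; rfl
  rw [h1, ← h2, ZMod.prod_Ico_one_prime]

/-- The factor i = m is exactly -pt; the others run over the nonzero residues, with product -1
modulo p by Wilson. -/
theorem negRising_powDvd {m : ℕ} (hm : m < p) {t : ℚ} (ht : PowDvd p 0 t) :
    PowDvd p 2 (negRising (m + p * t) p - p * t) := by
  have h1 : PowDvd p 1 (∏ i ∈ (range p).erase m, ((i : ℚ) - (m + p * t)) - -1) := by
    have h2 : PowDvd p 1 (∏ i ∈ (range p).erase m, ((i : ℚ) - (m + p * t)) -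
        ∏ i ∈ (range p).erase m, ((i : ℚ) - m)) := by
      refine PowDvd.prod_sub_prod (fun i _ => ?_) (fun i _ => ?_) (fun i _ => ?_)
      · have : ((i : ℚ) - (m + p * t) - (i - m)) = -(p * t) := by ring
        rw [this]
        exact (PowDvd.self.mul_right ht).neg
      · exact (PowDvd.nat i).sub ((PowDvd.nat m).add ((PowDvd.nat p).mul ht))
      · exact (PowDvd.nat i).sub (PowDvd.nat m)
    have h3 : PowDvd p 1 (∏ i ∈ (range p).erase m, ((i : ℚ) - m) - -1) := by
      have : (∏ i ∈ (range p).erase m, ((i : ℚ) - m) - -1) =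
          ((∏ i ∈ (range p).erase m, ((i : ℤ) - m) + 1 : ℤ) : ℚ) := by push_cast; ring
      rw [this, PowDvd.int_iff, pow_one, ← ZMod.intCast_zmod_eq_zero_iff_dvd]
      push_cast
      rw [prod_erase_sub_eq_neg_one hm]; ring
    convert h2.add h3 using 1; ring
  have h4 : negRising (m + p * t) p =
      -(p * t) * ∏ i ∈ (range p).erase m, ((i : ℚ) - (m + p * t)) := by
    rw [negRising, ← mul_prod_erase _ _ (mem_range.2 hm)]
    congr 1; ring
  rw [h4]
  have := ((PowDvd.self.mul_right ht).mul h1).neg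
  convert this using 1; ring

variable (hp2 : p ≠ 2)
include hp2

theorem exists_negRising_half : ∃ z, negRising (-1 / 2) p = p * z ∧ PowDvd p 1 (z - -1 / 2) := by
  have hodd := hp.out.eq_two_or_odd'.resolve_left hp2
  obtain ⟨k, hk⟩ := hodd
  have h2 : IsPUnit p 2 := IsPUnit.of_prime Nat.prime_two hp2
  -- -1/2 = (p-1)/2 + p·(-1/2).
  have := negRising_powDvd (p := p) (m := k) (by omega) (t := -1 / 2) (PowDvd.one.neg.div h2)
  have e : (k : ℚ) + p * (-1 / 2) = -1 / 2 := by
    have : (p : ℚ) = 2 * k + 1 := by exact_mod_cast hk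
    rw [this]; ring
  rw [e] at this
  have hp0 : (p : ℚ) ≠ 0 := by exact_mod_cast hp.out.ne_zero
  refine ⟨negRising (-1 / 2) p / p, by field_simp, PowDvd.of_self_mul ?_⟩
  convert this using 1; field_simp

theorem isPUnit_half : IsPUnit p (-1 / 2) :=
  IsPUnit.one.neg.div (IsPUnit.of_prime Nat.prime_two hp2)

theorem factorial_pred_powDvd : PowDvd p 1 (((p - 1).factorial : ℚ) - -1) := by
  have : (((p - 1).factorial : ℚ) - -1) = (((p - 1).factorial + 1 : ℤ) : ℚ) := by push_cast; ring
  rw [this, PowDvd.int_iff, pow_one, ← ZMod.intCast_zmod_eq_zero_iff_dvd]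
  push_cast
  rw [ZMod.wilsons_lemma]; ring

theorem negRising_pred (b : ℚ) : negRising b p = negRising b (p - 1) * (p - 1 - b) := by
  obtain ⟨q, hq⟩ : ∃ q, p = q + 1 := ⟨p - 1, by have := hp.out.pos; omega⟩
  rw [hq, Nat.add_sub_cancel, negRising, prod_range_succ, negRising]; push_cast; ring

/-- The factors p-1-a and p+a complete the numerators to length p. They stay on the left because
either may be divisible by p. -/
theorem hypTerm_pred_eq {a x y z : ℚ} (hx : negRising a p = p * x)
    (hy : negRising (-1 - a) p = p * y) (hz : negRising (-1 / 2) p = p * z) (hz0 : z ≠ 0) :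
    hypTerm a (p - 1) * ((p - 1 - a) * (p + a)) =
      p * (x * y * (p - 1 / 2)) / (z * (p - 1).factorial) := by
  have hp0 : (p : ℚ) ≠ 0 := by exact_mod_cast hp.out.ne_zero
  have h1 : negRising (-1 / 2) (p - 1) * (p - 1 / 2) = p * z := by
    rw [← hz, negRising_pred hp2]; ring
  have h2 : negRising a (p - 1) * (p - 1 - a) = p * x := by rw [← hx, negRising_pred hp2]
  have h3 : negRising (-1 - a) (p - 1) * (p + a) = p * y := by
    rw [← hy, negRising_pred hp2]; ring
  have h4 : negRising (-1 / 2) (p - 1) ≠ 0 := by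
    intro h; rw [h, zero_mul] at h1
    exact mul_ne_zero hp0 hz0 h1.symm
  have h5 : ((p - 1).factorial : ℚ) ≠ 0 := by exact_mod_cast Nat.factorial_ne_zero _
  rw [hypTerm_eq, div_mul_eq_mul_div, div_eq_div_iff (mul_ne_zero h4 h5) (mul_ne_zero hz0 h5)]
  calc _ = (negRising a (p - 1) * (p - 1 - a)) * (negRising (-1 - a) (p - 1) * (p + a)) * z
            * (p - 1).factorial := by ring
    _ = x * y * (p * z) * p * (p - 1).factorial := by rw [h2, h3]; ring
    _ = _ := by rw [← h1]; ring

theorem exists_negRising_eq {m : ℕ} (hm : m < p) {t a : ℚ} (ht : PowDvd p 0 t)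
    (ha : a = m + p * t) : ∃ x, negRising a p = p * x ∧ PowDvd p 1 (x - t) ∧ PowDvd p 0 x := by
  have hp0 : (p : ℚ) ≠ 0 := by exact_mod_cast hp.out.ne_zero
  have hx := negRising_powDvd hm ht
  rw [← ha] at hx
  have h1 : PowDvd p 1 (negRising a p / p - t) := by
    refine PowDvd.of_self_mul ?_
    convert hx using 1; field_simp
  refine ⟨negRising a p / p, by field_simp, h1, ?_⟩
  have := (h1.mono (Nat.zero_le 1)).add ht
  rwa [sub_add_cancel] at this

/-- The last term of the truncated series, modulo `p ^ 2`. -/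
theorem hypTerm_pred_powDvd {m : ℕ} (hm : m < p) {t a : ℚ} (ht : PowDvd p 0 t)
    (ha : a = m + p * t) :
    PowDvd p 2 (hypTerm a (p - 1) * ((p - 1 - a) * (p + a)) - p * (t * (t + 1))) := by
  obtain ⟨z, hz, hz1⟩ := exists_negRising_half hp2
  have hzu : IsPUnit p z := IsPUnit.of_sub hz1 (isPUnit_half hp2)
  have hf := factorial_pred_powDvd hp2
  have hfu : IsPUnit p ((p - 1).factorial : ℚ) := IsPUnit.of_sub hf IsPUnit.one.neg
  obtain ⟨x, hx', hx, hxi⟩ := exists_negRising_eq hp2 hm ht ha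
  obtain ⟨y, hy', hy, hyi⟩ := exists_negRising_eq hp2 (m := p - 1 - m) (a := -1 - a)
    (by have := hp.out.pos; omega) (ht.add .one).neg (by
      rw [Nat.cast_sub (by omega), Nat.cast_sub hp.out.one_le, ha]; push_cast; ring)
  have hden := hzu.mul hfu
  have h2 := PowDvd.mul_sub_mul hz1 hf (isPUnit_half hp2).powDvd hfu.powDvd
  rw [hypTerm_pred_eq hp2 hx' hy' hz hzu.ne_zero]
  generalize z * ((p - 1).factorial : ℚ) = d at *
  have e : p * (x * y * (p - 1 / 2)) / d - p * (t * (t + 1)) =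
      p * ((x * y * (p - 1 / 2) - t * (t + 1) * d) / d) := by
    have := hden.ne_zero
    field_simp
  have htt : PowDvd p 0 (t * (t + 1)) := ht.mul (ht.add .one)
  have h1 := PowDvd.mul_sub_mul hx hy ht hyi
  have h3 : PowDvd p 1 (x * y * p) := PowDvd.self.mul_left (hxi.mul hyi)
  have h4 : PowDvd p 1 (x * y * (p - 1 / 2) - t * (t + 1) * d) := by
    convert ((h1.mul_right (isPUnit_half hp2).powDvd).add h3).sub (h2.mul_left htt) using 1
    ring
  have h5 := PowDvd.self.mul (h4.div hden)
  rw [e]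
  exact h5

end

/-! ### The truncated series at m + pt modulo p². -/

/-- The alternating harmonic number `∑_{j=1}^m (-1)^j / j`. -/
def altHarmonic (m : ℕ) : ℚ := ∑ i ∈ range m, (-1) ^ (i + 1) / ((i : ℚ) + 1)

section

variable {p : ℕ} [hp : Fact p.Prime]

theorem IsPUnit.natCast_of_lt {k : ℕ} (h0 : 0 < k) (h : k < p) : IsPUnit p k :=
  IsPUnit.nat_iff.2 fun hd => absurd (Nat.le_of_dvd h0 hd) (by omega)

theorem negRising_succ (a : ℚ) (k : ℕ) : negRising a (k + 1) = negRising a k * (k - a) :=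
  prod_range_succ _ _

/-- The product is an integer polynomial in x with root 0, and p³ ∣ x³. Precision p³ is needed
because (1/2)_{k+1} may contain one factor p. -/
theorem exists_negRising_mul_approx (k : ℕ) : ∃ c d : ℚ, PowDvd p 0 c ∧ PowDvd p 0 d ∧
    ∀ x, PowDvd p 1 x →
      PowDvd p 3 (negRising x (k + 1) * negRising (-1 - x) (k + 1) - (c * x + d * x ^ 2)) := by
  induction k with
  | zero =>
    refine ⟨-1, -1, PowDvd.one.neg, PowDvd.one.neg, fun x _ => ?_⟩
    convert PowDvd.zero (p := p) using 1
    simp [negRising]; ring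
  | succ k ih =>
    obtain ⟨c, d, hc, hd, h⟩ := ih
    have hb : PowDvd p 0 (((k + 1) * (k + 2) : ℕ) : ℚ) := PowDvd.nat _
    -- The new factor is (k+1-x)(k+2+x) = (k+1)(k+2) - x - x².
    refine ⟨((k + 1) * (k + 2) : ℕ) * c, ((k + 1) * (k + 2) : ℕ) * d - c, hb.mul hc,
      (hb.mul hd).sub hc, fun x hx => ?_⟩
    have hx0 : PowDvd p 0 x := hx.mono (Nat.zero_le 1)
    have h1 := (h x hx).mul_right ((hb.sub hx0).sub (hx0.mul hx0))
    have h2 : PowDvd p 3 (x * x * x * (-d * x - (c + d))) :=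
      ((hx.mul hx).mul hx).mul_right ((hd.neg.mul hx0).sub (hc.add hd))
    rw [negRising_succ, negRising_succ _ (k + 1)]
    have h3 := h1.add h2
    convert h3 using 1
    push_cast
    ring

variable (hp2 : p ≠ 2)
include hp2

/-- (1/2)_k divides (1/2)_p, which is p times a unit. -/
theorem exists_mul_negRising_half {k : ℕ} (hk : k ≤ p) :
    ∃ w, PowDvd p 0 w ∧ negRising (-1 / 2) k * w = p := by
  obtain ⟨z, hz, hz1⟩ := exists_negRising_half hp2
  have hzu : IsPUnit p z := IsPUnit.of_sub hz1 (isPUnit_half hp2)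
  refine ⟨(∏ i ∈ Ico k p, ((i : ℚ) - -1 / 2)) / z, PowDvd.div (PowDvd.prod fun i _ => ?_) hzu, ?_⟩
  · exact (PowDvd.nat i).sub (isPUnit_half hp2).powDvd
  · rw [← mul_div_assoc, div_eq_iff hzu.ne_zero, ← hz]
    exact prod_range_mul_prod_Ico _ hk

theorem exists_hypTerm_approx {k : ℕ} (hk : k + 1 < p) : ∃ c d : ℚ,
    ∀ t, PowDvd p 0 t → PowDvd p 2 (hypTerm (p * t) (k + 1) - (c * t + d * t ^ 2)) := by
  obtain ⟨c, d, hc, hd, h⟩ := exists_negRising_mul_approx (p := p) k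
  obtain ⟨w, hw, hwp⟩ := exists_mul_negRising_half hp2 hk.le
  have hp0 : (p : ℚ) ≠ 0 := by exact_mod_cast hp.out.ne_zero
  have hfu : IsPUnit p ((k + 1).factorial : ℚ) :=
    IsPUnit.nat_iff.2 fun hd => by
      rw [hp.out.dvd_factorial] at hd; omega
  refine ⟨c * w / (k + 1).factorial, p * d * w / (k + 1).factorial, fun t ht => ?_⟩
  have h1 := (((h (p * t) (PowDvd.self.mul_right ht)).mul_right hw).div hfu)
  apply PowDvd.of_self_mul
  convert h1 using 1
  have h2 : negRising (-1 / 2) (k + 1) ≠ 0 := by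
    intro h; rw [h, zero_mul] at hwp; exact hp0 hwp.symm
  rw [hypTerm_eq]
  have h3 := hfu.ne_zero
  generalize ((k + 1).factorial : ℚ) = f at *
  generalize negRising (p * t) (k + 1) = M at *
  generalize negRising (-1 - p * t) (k + 1) = N at *
  generalize negRising (-1 / 2) (k + 1) = H at *
  rw [← hwp]
  field_simp

theorem exists_hypSum_approx : ∃ c d : ℚ,
    ∀ t, PowDvd p 0 t → PowDvd p 2 (hypSum (p * t) p - 1 - (c * t + d * t ^ 2)) := by
  have h : ∀ k, ∃ c d : ℚ, k + 1 < p →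
      ∀ t, PowDvd p 0 t → PowDvd p 2 (hypTerm (p * t) (k + 1) - (c * t + d * t ^ 2)) := fun k => by
    by_cases hk : k + 1 < p
    · obtain ⟨c, d, h⟩ := exists_hypTerm_approx hp2 hk
      exact ⟨c, d, fun _ => h⟩
    · exact ⟨0, 0, fun h => absurd h hk⟩
  choose c d h using h
  refine ⟨∑ k ∈ range (p - 1), c k, ∑ k ∈ range (p - 1), d k, fun t ht => ?_⟩
  have h1 : PowDvd p 2 (∑ k ∈ range (p - 1),
      (hypTerm (p * t) (k + 1) - (c k * t + d k * t ^ 2))) :=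
    PowDvd.sum fun k hk => h k (by have := mem_range.1 hk; omega) t ht
  have h2 : hypSum (p * t) p = ∑ k ∈ range (p - 1), hypTerm (p * t) (k + 1) + 1 := by
    rw [hypSum, ← hypTerm_zero (p * t), ← sum_range_succ', Nat.sub_add_cancel hp.out.one_le]
  convert h1 using 1
  rw [h2, sum_sub_distrib, sum_add_distrib, sum_mul, sum_mul]
  ring

theorem even_pred : Even (p - 1) := hp.out.even_sub_one hp2

theorem hypSum_self_mul_powDvd {t : ℚ} (ht : PowDvd p 0 t) :
    PowDvd p 2 (hypSum (p * t) p -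
      (1 + 2 * t - 2 * p * t + 2 * (4 ^ (p - 1) - 1) * (t * (t + 1)))) := by
  obtain ⟨c, d, h⟩ := exists_hypSum_approx hp2
  have h1 := h 1 .one
  have h2 := h (-1) PowDvd.one.neg
  have h3 := h t ht
  have he := even_pred hp2
  obtain ⟨n, hn⟩ : ∃ n, p = n + 1 := ⟨p - 1, by have := hp.out.pos; omega⟩
  have hn' : (p : ℚ) = n + 1 := by exact_mod_cast hn
  have e1 := hypSum_self (n := n) (by rwa [hn] at he)
  have e2 := hypSum_neg (n := n) (by rwa [hn] at he)
  rw [← hn] at e1 e2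
  rw [mul_one, e1] at h1
  rw [mul_neg_one, e2] at h2
  have e3 : p - 1 = n := by omega
  rw [e3]
  have htt : PowDvd p 0 (t ^ 2) := ht.pow 2
  have hu : IsPUnit p 2 := IsPUnit.of_prime Nat.prime_two hp2
  apply PowDvd.of_mul hu
  -- Modulo p², 2c is the difference of the values at t = 1 and t = -1, and 2d is their sum less 2.
  have h4 := ((h3.mul_left .two).sub ((h1.sub h2).mul_left ht)).sub ((h1.add h2).mul_left htt)
  convert h4 using 1
  have h5 : (4 : ℚ) ^ p = 4 ^ n * 4 := by rw [hn, pow_succ]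
  generalize hypSum (p * t) p = S at *
  rw [h5, hn']
  ring

theorem four_pow_sub_one_powDvd : PowDvd p 1 ((4 : ℚ) ^ (p - 1) - 1) := by
  have : (4 : ℚ) ^ (p - 1) - 1 = ((4 ^ (p - 1) - 1 : ℤ) : ℚ) := by push_cast; ring
  rw [this, PowDvd.int_iff, pow_one, ← ZMod.intCast_zmod_eq_zero_iff_dvd]
  push_cast
  have h4 : (4 : ZMod p) ≠ 0 := by
    have : ¬ p ∣ 2 ^ 2 := fun h =>
      hp2 ((Nat.prime_dvd_prime_iff_eq hp.out Nat.prime_two).1 (hp.out.dvd_of_dvd_pow h))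
    have h := (ZMod.natCast_eq_zero_iff (2 ^ 2) p).not.2 this
    norm_num at h
    exact h
  rw [ZMod.pow_card_sub_one_eq_one h4, sub_self]

/-- Formally, U(a) = (S(a) + 4pt(t+1))/(2a+1) satisfies U(a) + U(a-1) ≡ 4pt(t+1)/a, because
1/(a(4a²-1)) = 1/(2a-1) + 1/(2a+1) - 1/a. The statement is multiplied by 2a+1, which is not a unit
when 2m+1 = p. -/
theorem hypSum_powDvd_altHarmonic {t : ℚ} (ht : PowDvd p 0 t) {m : ℕ} (hm : 2 * m < p) :
    PowDvd p 2 (hypSum (m + p * t) p -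
      ((2 * (m + p * t) + 1) * ((-1) ^ m * (1 + 2 * t + 2 * (4 ^ (p - 1) - 1) * (t * (t + 1))
        + 4 * p * (t * (t + 1)) * altHarmonic m)) - 4 * p * (t * (t + 1)))) := by
  have htt : PowDvd p 0 (t * (t + 1)) := ht.mul (ht.add .one)
  have hpt : PowDvd p 1 (p * t) := PowDvd.self.mul_right ht
  induction m with
  | zero =>
    have h1 := hypSum_self_mul_powDvd hp2 ht
    have h2 : PowDvd p 2 (4 * (p * t * (4 ^ (p - 1) - 1)) * (t * (t + 1))) :=
      ((hpt.mul (four_pow_sub_one_powDvd hp2)).mul_left .four).mul_right htt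
    have h3 := h1.sub h2
    convert h3 using 1
    simp only [altHarmonic, range_zero, sum_empty, Nat.cast_zero, zero_add, pow_zero]
    ring
  | succ m ih =>
    have e1 := ih (by omega)
    obtain ⟨a, ha⟩ : ∃ a : ℚ, a = (m + 1 : ℕ) + p * t := ⟨_, rfl⟩
    have e2 := hypTerm_pred_powDvd hp2 (m := m + 1) (by omega) ht ha
    have hr := hypSum_recurrence a (p - 1)
    rw [Nat.sub_add_cancel hp.out.one_le, Nat.cast_sub hp.out.one_le] at hr
    have ha1 : (m : ℚ) + p * t = a - 1 := by rw [ha]; push_cast; ring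
    rw [← ha]
    rw [ha1] at e1
    have hai : PowDvd p 0 a := by
      rw [ha]; exact (PowDvd.nat _).add (hpt.mono (Nat.zero_le 1))
    have hj : IsPUnit p ((m + 1 : ℕ) : ℚ) := IsPUnit.natCast_of_lt (Nat.succ_pos m) (by omega)
    have hu1 : IsPUnit p (p + a) := by
      refine IsPUnit.of_sub (y := ((m + 1 : ℕ) : ℚ)) ?_ hj
      convert PowDvd.self.add hpt using 1
      rw [ha]; ring
    have hu2 : IsPUnit p (2 * a - 1) := by
      refine IsPUnit.of_sub (y := ((2 * m + 1 : ℕ) : ℚ)) ?_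
        (IsPUnit.natCast_of_lt (Nat.succ_pos _) (by omega))
      convert hpt.mul_left .two using 1
      rw [ha]; push_cast; ring
    apply PowDvd.of_mul (hu1.mul hu2)
    -- Collects the error of identifying a, p+a and m+1, congruent modulo p, in terms already
    -- divisible by p.
    have e3 : PowDvd p 2 ((p * (4 * (t * (t + 1)))) * (p * (1 + t - 4 * a * t * (p + a))) /
        (m + 1 : ℕ)) := by
      have h1 : PowDvd p 1 (p * (4 * (t * (t + 1)))) :=
        PowDvd.self.mul_right (PowDvd.four.mul htt)
      have h2 : PowDvd p 1 (p * (1 + t - 4 * a * t * (p + a))) :=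
        PowDvd.self.mul_right ((PowDvd.one.add ht).sub
          (((PowDvd.four.mul hai).mul ht).mul ((PowDvd.nat p).add hai)))
      exact (h1.mul h2).div hj
    have e4 := ((e2.mul_left PowDvd.four.neg).sub
      (e1.mul_left ((hu1.powDvd).mul ((PowDvd.two.mul hai).add .one)))).add e3
    convert e4 using 1
    have hs : altHarmonic (m + 1) = altHarmonic m - (-1) ^ m / (m + 1 : ℕ) := by
      rw [altHarmonic, sum_range_succ, ← altHarmonic, pow_succ]; push_cast; ring
    have hsq : ((-1 : ℚ) ^ m) ^ 2 = 1 := by rw [← pow_mul, mul_comm, pow_mul]; simp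
    rw [hs, pow_succ]
    have hj0 := hj.ne_zero
    generalize ((m + 1 : ℕ) : ℚ) = j at *
    generalize (-1 : ℚ) ^ m = s at *
    generalize altHarmonic m = h at *
    generalize (4 : ℚ) ^ (p - 1) = q at *
    generalize hypSum a p = S at *
    generalize hypSum (a - 1) p = S' at *
    generalize hypTerm a (p - 1) = T at *
    obtain rfl : j = a - p * t := by rw [ha]; ring
    push_cast at hr
    rcases eq_or_eq_neg_of_sq_eq_sq s 1 (by rw [hsq, one_pow]) with rfl | rfl <;> field_simp
    · linear_combination (p + a) * (a - p * t) * hr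
    · linear_combination (p + a) * (a - p * t) * hr

end

/-! ### Euler polynomials: identities and congruences. -/

theorem eulerPolynomial_recurrence (n : ℕ) :
    eulerPolynomial n + ∑ k ∈ range (n + 1), (n.choose k : Polynomial ℚ) * eulerPolynomial k =
      2 * Polynomial.X ^ n := by
  set G : PowerSeries (Polynomial ℚ) :=
    2 * PowerSeries.rescale (Polynomial.X : Polynomial ℚ) (PowerSeries.exp (Polynomial ℚ)) *
      PowerSeries.map Polynomial.C ((PowerSeries.exp ℚ + 1)⁻¹ : PowerSeries ℚ) with hG
  have hE : ∀ k, eulerPolynomial k = (k.factorial : Polynomial ℚ) * PowerSeries.coeff k G :=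
    fun _ => rfl
  have h1 : G * (PowerSeries.exp (Polynomial ℚ) + 1) =
      2 * PowerSeries.rescale (Polynomial.X : Polynomial ℚ) (PowerSeries.exp (Polynomial ℚ)) := by
    have : PowerSeries.exp (Polynomial ℚ) + 1 =
        PowerSeries.map Polynomial.C (PowerSeries.exp ℚ + 1) := by
      rw [map_add, map_one, PowerSeries.map_exp]
    rw [hG, this, mul_assoc, ← map_mul, PowerSeries.inv_mul_cancel, map_one, mul_one]
    rw [map_add, PowerSeries.constantCoeff_exp]; simp
  have h2 := congrArg (fun F => (n.factorial : Polynomial ℚ) * PowerSeries.coeff n F) h1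
  simp only [mul_add, mul_one, map_add] at h2
  have h3 : (2 : PowerSeries (Polynomial ℚ)) = PowerSeries.C 2 := (map_ofNat PowerSeries.C 2).symm
  rw [h3, PowerSeries.coeff_C_mul, PowerSeries.coeff_rescale, PowerSeries.coeff_mul,
    ← hE, Finset.Nat.sum_antidiagonal_eq_sum_range_succ_mk] at h2
  have hfac : ∀ k : ℕ,
      (k.factorial : Polynomial ℚ) * algebraMap ℚ (Polynomial ℚ) (1 / k.factorial) = 1 := by
    intro k
    have : (k.factorial : Polynomial ℚ) = algebraMap ℚ (Polynomial ℚ) k.factorial := by simp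
    rw [this, ← map_mul, mul_one_div_cancel (by exact_mod_cast Nat.factorial_ne_zero k), map_one]
  have h4 : (n.factorial : Polynomial ℚ) * (2 * (Polynomial.X ^ n *
      PowerSeries.coeff n (PowerSeries.exp (Polynomial ℚ)))) = 2 * Polynomial.X ^ n := by
    rw [PowerSeries.coeff_exp]
    linear_combination 2 * Polynomial.X ^ n * hfac n
  rw [h4] at h2
  rw [← h2, add_comm, mul_sum]
  congr 1
  refine sum_congr rfl fun k hk => ?_
  have hkn : k ≤ n := Nat.lt_succ_iff.1 (mem_range.1 hk)
  rw [hE, ← Nat.choose_mul_factorial_mul_factorial hkn, PowerSeries.coeff_exp]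
  push_cast
  linear_combination
    (-(n.choose k : Polynomial ℚ) * k.factorial * PowerSeries.coeff k G) * hfac (n - k)

theorem eulerPolynomial_eval_recurrence (n : ℕ) (x : ℚ) :
    2 * (eulerPolynomial n).eval x =
      2 * x ^ n - ∑ k ∈ range n, (n.choose k : ℚ) * (eulerPolynomial k).eval x := by
  have h := congrArg (Polynomial.eval x) (eulerPolynomial_recurrence n)
  simp only [Polynomial.eval_add, Polynomial.eval_finsetSum, Polynomial.eval_mul,
    Polynomial.eval_natCast, sum_range_succ, Nat.choose_self, Polynomial.eval_pow,
    Polynomial.eval_X, Polynomial.eval_ofNat, Nat.cast_one, Polynomial.eval_one] at h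
  linarith

theorem eulerPolynomial_eval_add_one (n : ℕ) (x : ℚ) :
    (eulerPolynomial n).eval (x + 1) + (eulerPolynomial n).eval x = 2 * x ^ n := by
  induction n using Nat.strong_induction_on with
  | _ n ih =>
    have h1 := eulerPolynomial_eval_recurrence n x
    have h2 := eulerPolynomial_eval_recurrence n (x + 1)
    have h3 : ∑ k ∈ range n, (n.choose k : ℚ) * (eulerPolynomial k).eval (x + 1) +
        ∑ k ∈ range n, (n.choose k : ℚ) * (eulerPolynomial k).eval x =
        2 * ∑ k ∈ range n, x ^ k * (n.choose k : ℚ) := by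
      rw [← sum_add_distrib, mul_sum]
      refine sum_congr rfl fun k hk => ?_
      rw [← mul_add, ih k (mem_range.1 hk)]; ring
    have h4 := add_pow x 1 n
    simp only [one_pow, mul_one, sum_range_succ, Nat.choose_self, Nat.cast_one] at h4
    linarith

/-- The difference d of the two sides satisfies d(y+1) = -d(y). It is therefore constant on even
naturals, hence constant, hence zero. -/
theorem eulerPolynomial_eval_one_sub (n : ℕ) (x : ℚ) :
    (eulerPolynomial n).eval (1 - x) = (-1) ^ n * (eulerPolynomial n).eval x := by
  set d : Polynomial ℚ := (eulerPolynomial n).comp (1 - Polynomial.X) -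
    Polynomial.C ((-1) ^ n) * eulerPolynomial n with hd
  have hde : ∀ y, d.eval y =
      (eulerPolynomial n).eval (1 - y) - (-1) ^ n * (eulerPolynomial n).eval y := by
    intro y; simp [hd]
  have hper : ∀ y, d.eval (y + 1) = -d.eval y := by
    intro y
    have h1 := eulerPolynomial_eval_add_one n y
    have h2 := eulerPolynomial_eval_add_one n (-y)
    have e1 : 1 - (y + 1) = -y := by ring
    have e2 : -y + 1 = 1 - y := by ring
    have e3 : (-y) ^ n = (-1) ^ n * y ^ n := by rw [neg_eq_neg_one_mul, mul_pow]
    rw [e2, e3] at h2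
    rw [hde, hde, e1]
    linear_combination h2 - (-1) ^ n * h1
  have hnat : ∀ k : ℕ, d.eval ((2 * k : ℕ) : ℚ) = d.eval 0 := by
    intro k
    induction k with
    | zero => simp
    | succ k ih =>
      have : ((2 * (k + 1) : ℕ) : ℚ) = ((2 * k : ℕ) : ℚ) + 1 + 1 := by push_cast; ring
      rw [this, hper, hper, neg_neg, ih]
  have hconst : d = Polynomial.C (d.eval 0) := by
    refine Polynomial.eq_of_infinite_eval_eq _ _ (Set.Infinite.mono ?_
      (Set.infinite_range_of_injective (f := fun k : ℕ => ((2 * k : ℕ) : ℚ)) ?_))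
    · rintro _ ⟨k, rfl⟩
      simp only [Set.mem_ofPred_eq, Polynomial.eval_C]
      exact hnat k
    · intro a b h
      simpa using h
  have hval : ∀ y, d.eval y = d.eval 0 := fun y => by
    rw [hconst]; simp only [Polynomial.eval_C]
  have h0 := hper x
  rw [hval (x + 1), hval x] at h0
  have h1 := hde x
  rw [hval x] at h1
  linarith

theorem eulerPolynomial_alternating_sum (n m : ℕ) :
    2 * ∑ i ∈ range m, (-1 : ℚ) ^ (i + 1) * ((i : ℚ) + 1) ^ n =
      (-1) ^ m * (eulerPolynomial n).eval ((m : ℚ) + 1) - (eulerPolynomial n).eval 1 := by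
  induction m with
  | zero => simp
  | succ m ih =>
    rw [sum_range_succ, mul_add, ih]
    have h := eulerPolynomial_eval_add_one n ((m : ℚ) + 1)
    push_cast
    rw [pow_succ]
    linear_combination (-1 : ℚ) ^ m * h

section

variable {p : ℕ} [hp : Fact p.Prime] (hp2 : p ≠ 2)
include hp2

theorem eulerPolynomial_eval_powDvd (n : ℕ) {x : ℚ} (hx : PowDvd p 0 x) :
    PowDvd p 0 ((eulerPolynomial n).eval x) := by
  induction n using Nat.strong_induction_on with
  | _ n ih =>
    apply PowDvd.of_mul (IsPUnit.of_prime Nat.prime_two hp2)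
    rw [Nat.cast_ofNat, eulerPolynomial_eval_recurrence]
    exact (PowDvd.two.mul (hx.pow n)).sub
      (PowDvd.sum fun k hk => (PowDvd.nat _).mul (ih k (mem_range.1 hk)))

theorem eulerPolynomial_eval_sub_powDvd (n : ℕ) {x y : ℚ} (hx : PowDvd p 0 x) (hy : PowDvd p 0 y)
    (h : PowDvd p 1 (x - y)) :
    PowDvd p 1 ((eulerPolynomial n).eval x - (eulerPolynomial n).eval y) := by
  induction n using Nat.strong_induction_on with
  | _ n ih =>
    apply PowDvd.of_mul (IsPUnit.of_prime Nat.prime_two hp2)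
    rw [Nat.cast_ofNat, mul_sub, eulerPolynomial_eval_recurrence, eulerPolynomial_eval_recurrence]
    have hpow : ∀ n : ℕ, PowDvd p 1 (x ^ n - y ^ n) := by
      intro n
      induction n with
      | zero => simpa using PowDvd.zero
      | succ n ih =>
        rw [pow_succ, pow_succ]
        exact PowDvd.mul_sub_mul ih h (hy.pow n) hx
    have hs : PowDvd p 1 (∑ k ∈ range n, (n.choose k : ℚ) *
        ((eulerPolynomial k).eval x - (eulerPolynomial k).eval y)) :=
      PowDvd.sum fun k hk => (ih k (mem_range.1 hk)).mul_left (PowDvd.nat _)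
    convert ((hpow n).mul_left .two).sub hs using 1
    simp only [mul_sub, sum_sub_distrib]
    ring

theorem inv_sub_pow_powDvd {j : ℕ} (h0 : 0 < j) (h : j < p) :
    PowDvd p 1 (1 / (j : ℚ) - (j : ℚ) ^ (p - 2)) := by
  have hu := IsPUnit.natCast_of_lt h0 h
  apply PowDvd.of_mul hu
  have hj := hu.ne_zero
  have hp3 : p - 1 = p - 2 + 1 := by
    have := hp.out.two_le
    omega
  have : (j : ℚ) * (1 / j - (j : ℚ) ^ (p - 2)) = ((1 - (j : ℤ) ^ (p - 1) : ℤ) : ℚ) := by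
    rw [hp3, pow_succ]; push_cast; field_simp
  rw [this, PowDvd.int_iff, pow_one, ← ZMod.intCast_zmod_eq_zero_iff_dvd]
  push_cast
  have hj' : (j : ZMod p) ≠ 0 := fun hh =>
    IsPUnit.nat_iff.1 hu ((ZMod.natCast_eq_zero_iff j p).1 hh)
  rw [ZMod.pow_card_sub_one_eq_one hj', sub_self]

/-- Fermat replaces 1/j by j^(p-2), and the alternating power sum telescopes through E(x+1) + E(x) =
2x^(p-2). -/
theorem two_mul_altHarmonic_powDvd {m : ℕ} (hm : m < p) :
    PowDvd p 1 (2 * altHarmonic m -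
      ((-1) ^ m * (eulerPolynomial (p - 2)).eval ((m : ℚ) + 1) +
        (eulerPolynomial (p - 2)).eval 0)) := by
  have h1 : (eulerPolynomial (p - 2)).eval 1 = -(eulerPolynomial (p - 2)).eval 0 := by
    have h := eulerPolynomial_eval_add_one (p - 2) 0
    have hp3 := hp.out.two_le
    rw [zero_add, zero_pow (by omega)] at h
    linarith
  have h2 := eulerPolynomial_alternating_sum (p - 2) m
  rw [h1, sub_neg_eq_add] at h2
  rw [← h2, ← mul_sub, altHarmonic, ← sum_sub_distrib]
  refine PowDvd.mul_left (PowDvd.sum fun i hi => ?_) .two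
  have h3 := inv_sub_pow_powDvd hp2 (Nat.succ_pos i) (by have := mem_range.1 hi; omega)
  convert h3.mul_left (PowDvd.one.neg.pow (i + 1)) using 1
  push_cast; ring

/-- Expand 2^p binomially with C(p, i+1) = p C(p-1, i)/(i+1) and C(p-1, i) ≡ (-1)^i modulo p. -/
theorem two_pow_sub_two_powDvd : PowDvd p 2 ((2 : ℚ) ^ p - 2 + p * altHarmonic (p - 1)) := by
  have hch : ∀ i < p, PowDvd p 1 (((p - 1).choose i : ℚ) - (-1) ^ i) := by
    intro i
    induction i with
    | zero => intro _; simpa using PowDvd.zero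
    | succ i ih =>
      intro hi
      have h1 := ih (by omega)
      have h2 : p.choose (i + 1) = (p - 1).choose i + (p - 1).choose (i + 1) := by
        conv_lhs => rw [← Nat.sub_add_cancel hp.out.one_le]
        exact Nat.choose_succ_succ _ _
      have h3 : PowDvd p 1 (p.choose (i + 1) : ℚ) := by
        have := hp.out.dvd_choose_self (Nat.succ_ne_zero i) hi
        rw [← Int.natCast_dvd_natCast] at this
        have h := (PowDvd.int_iff (n := 1)).2 (by simpa using this)
        exact_mod_cast h
      rw [h2] at h3
      convert h3.sub h1 using 1
      push_cast; ring
  have h2 : (2 : ℚ) ^ p - 2 =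
      ∑ i ∈ range (p - 1), (p * ((p - 1).choose i : ℚ)) / ((i + 1 : ℕ) : ℚ) := by
    obtain ⟨q, hq⟩ : ∃ q, p = q + 1 := ⟨p - 1, by have := hp.out.pos; omega⟩
    have h := Nat.sum_range_choose p
    rw [sum_range_succ, hq, sum_range_succ', Nat.choose_zero_right, Nat.choose_self] at h
    have h : (2 : ℚ) ^ (q + 1) = (∑ i ∈ range q, ((q + 1).choose (i + 1) : ℚ)) + 1 + 1 := by
      exact_mod_cast h.symm
    rw [hq, h, Nat.add_sub_cancel]
    have : ∀ i ∈ range q, ((q + 1).choose (i + 1) : ℚ) =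
        (((q + 1 : ℕ) : ℚ) * (q.choose i : ℚ)) / ((i + 1 : ℕ) : ℚ) := by
      intro i _
      rw [eq_div_iff (by positivity)]
      exact_mod_cast (Nat.add_one_mul_choose_eq q i).symm
    rw [← sum_congr rfl this]; ring
  rw [h2, altHarmonic, mul_sum, ← sum_add_distrib]
  refine PowDvd.sum fun i hi => ?_
  have hi' := mem_range.1 hi
  have hu : IsPUnit p ((i + 1 : ℕ) : ℚ) := IsPUnit.natCast_of_lt (Nat.succ_pos i) (by omega)
  have := PowDvd.self.mul ((hch i (by omega)).div hu)
  convert this using 1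
  rw [pow_succ]; push_cast; ring

theorem four_pow_sub_one_add_powDvd :
    PowDvd p 2 ((4 : ℚ) ^ (p - 1) - 1 + p * (eulerPolynomial (p - 2)).eval 0) := by
  have h1 := two_pow_sub_two_powDvd hp2
  have h2 := two_mul_altHarmonic_powDvd hp2 (m := p - 1) (by have := hp.out.pos; omega)
  have h3 := eulerPolynomial_eval_sub_powDvd hp2 (p - 2) (PowDvd.nat p)
    (PowDvd.zero (p := p) (n := 0))
    (by simpa using PowDvd.self)
  have hp1 : ((p - 1 : ℕ) : ℚ) + 1 = p := by
    rw [Nat.cast_sub hp.out.one_le]; push_cast; ring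
  rw [(even_pred hp2).neg_one_pow, hp1, one_mul] at h2
  have h4 : PowDvd p 1 (altHarmonic (p - 1) - (eulerPolynomial (p - 2)).eval 0) := by
    apply PowDvd.of_mul (IsPUnit.of_prime Nat.prime_two hp2)
    convert h2.add h3 using 1
    push_cast; ring
  have h5 := h1.sub (PowDvd.self.mul h4)
  have h6 : PowDvd p 1 ((2 : ℚ) ^ p - 2) := by
    have hE : PowDvd p 0 (altHarmonic (p - 1)) := by
      have h := (h4.mono (Nat.zero_le 1)).add (eulerPolynomial_eval_powDvd hp2 (p - 2) .zero)
      rwa [sub_add_cancel] at h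
    convert (h1.mono one_le_two).sub (PowDvd.self.mul_right hE) using 1; ring
  -- 4^(p-1) - 1 = (2^p - 2) + ((2^p - 2)/2)², and the square vanishes modulo p².
  have h7 : PowDvd p 2 (((2 : ℚ) ^ p - 2) * (2 ^ p - 2) / (2 ^ 2 : ℚ)) := by
    have h22 : IsPUnit p ((2 : ℚ) ^ 2) := by
      rw [pow_two]
      exact (IsPUnit.of_prime Nat.prime_two hp2).mul (IsPUnit.of_prime Nat.prime_two hp2)
    exact (h6.mul h6).div h22
  convert h5.add h7 using 1
  have e1 : (2 : ℚ) ^ p = 2 ^ (p - 1) * 2 := by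
    rw [← pow_succ, Nat.sub_add_cancel hp.out.one_le]
  have e2 : (4 : ℚ) ^ (p - 1) = 2 ^ (p - 1) * 2 ^ (p - 1) := by
    rw [← mul_pow]; norm_num
  rw [e1, e2]; ring

end

/-! ### Both families of sums in terms of E_{p-2}(r). -/

/-- The value of the truncated series `∑_{k<p} (r)_k (1-r)_k / ((1/2)_k k!)` modulo `p ^ 2`,
where `s = ±1` is the sign attached to the residue of `-r` modulo `p`. -/
noncomputable def hypValue (p : ℕ) (r s : ℚ) : ℚ :=
  s * (1 - 2 * r) ^ 2 +
    4 * p * (r * (1 - r)) * (1 + 1 / 2 * (1 - 2 * r) * (eulerPolynomial (p - 2)).eval r)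

/-- The sign `s` is `(-1) ^ m` or `-(-1) ^ m` according to whether `-r` or `r - 1` is congruent
to some `m < p / 2` modulo `p`, with quotient `-r`. -/
def IsHypSign (p : ℕ) (r s : ℚ) : Prop :=
  ∃ m : ℕ, 2 * m < p ∧
    ((-r = m + p * -r ∧ s = (-1) ^ m) ∨ (r - 1 = m + p * -r ∧ s = -(-1) ^ m))

section

variable {p : ℕ} [hp : Fact p.Prime] (hp2 : p ≠ 2)
include hp2

theorem hypSum_powDvd_euler {t a : ℚ} (ht : PowDvd p 0 t) {m : ℕ} (hm : 2 * m < p)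
    (ha : a = m + p * t) :
    PowDvd p 2 (hypSum a p -
      ((2 * a + 1) * ((-1) ^ m * (1 + 2 * t) +
        2 * p * (t * (t + 1)) * (eulerPolynomial (p - 2)).eval ((m : ℚ) + 1)) -
          4 * p * (t * (t + 1)))) := by
  have h1 := hypSum_powDvd_altHarmonic hp2 ht hm
  have h2 := four_pow_sub_one_add_powDvd hp2
  have h3 := PowDvd.self.mul (two_mul_altHarmonic_powDvd hp2 (m := m) (by omega))
  have hai : PowDvd p 0 a := by rw [ha]; exact (PowDvd.nat m).add ((PowDvd.nat p).mul ht)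
  have hw : PowDvd p 0 ((2 * a + 1) * (-1) ^ m * (2 * (t * (t + 1)))) :=
    (((PowDvd.two.mul hai).add .one).mul (PowDvd.one.neg.pow m)).mul
      (PowDvd.two.mul (ht.mul (ht.add .one)))
  rw [← ha] at h1
  have h4 := h1.add ((h2.add h3).mul_left hw)
  convert h4 using 1
  have hs : (-1 : ℚ) ^ m = 1 ∨ (-1 : ℚ) ^ m = -1 := neg_one_pow_eq_or ℚ m
  rcases hs with hs | hs <;> rw [hs] <;> ring

theorem neg_one_pow_sub_two : (-1 : ℚ) ^ (p - 2) = -1 := by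
  have h := hp.out.eq_two_or_odd'.resolve_left hp2
  exact Odd.neg_one_pow (Nat.Odd.sub_even hp.out.two_le h even_two)

/-- In the first case m+1 ≡ 1-r and reflection, with p-2 odd, gives -E(r). In the second m+1 ≡ r,
and the symmetry a ↔ -1-a turns r-1 into -r. -/
theorem hypSum_sub_hypValue_powDvd {r s : ℚ} (hr : PowDvd p 0 r) (hs : IsHypSign p r s) :
    PowDvd p 2 (hypSum (-r) p - hypValue p r s) := by
  obtain ⟨m, hm, ⟨ha, rfl⟩ | ⟨ha, rfl⟩⟩ := hs
  · have h1 := hypSum_powDvd_euler hp2 hr.neg hm ha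
    have h2 := eulerPolynomial_eval_sub_powDvd hp2 (p - 2) (x := (m : ℚ) + 1) (y := 1 - r)
      ((PowDvd.nat m).add .one) (PowDvd.one.sub hr) (by
        convert PowDvd.self.mul_right hr using 1
        linear_combination -ha)
    rw [eulerPolynomial_eval_one_sub, neg_one_pow_sub_two hp2] at h2
    have hw : PowDvd p 0 ((1 - 2 * r) * (2 * (-r * (-r + 1)))) :=
      (PowDvd.one.sub (PowDvd.two.mul hr)).mul
        (PowDvd.two.mul (hr.neg.mul (hr.neg.add .one)))
    have h3 := h1.add ((PowDvd.self.mul h2).mul_left hw)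
    convert h3 using 1
    rw [hypValue]; ring
  · have h1 := hypSum_powDvd_euler hp2 hr.neg hm ha
    have h2 := eulerPolynomial_eval_sub_powDvd hp2 (p - 2) (x := (m : ℚ) + 1) (y := r)
      ((PowDvd.nat m).add .one) hr (by
        convert PowDvd.self.mul_right hr using 1
        linear_combination -ha)
    have hw : PowDvd p 0 ((2 * r - 1) * (2 * (-r * (-r + 1)))) :=
      ((PowDvd.two.mul hr).sub .one).mul
        (PowDvd.two.mul (hr.neg.mul (hr.neg.add .one)))
    have h3 := h1.add ((PowDvd.self.mul h2).mul_left hw)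
    have e : r - 1 = -1 - -r := by ring
    rw [e, hypSum_symm] at h3
    convert h3 using 1
    rw [hypValue]; ring

theorem hypTerm_pred_add_self_powDvd {r s : ℚ} (hr : PowDvd p 0 r) (hs : IsHypSign p r s)
    (hu : IsPUnit p (r * (1 - r))) : PowDvd p 2 (hypTerm (-r) (p - 1) + p) := by
  have h1 :
      PowDvd p 2 (hypTerm (-r) (p - 1) * (p * (p - 1) + r * (1 - r)) + p * (r * (1 - r))) := by
    obtain ⟨m, hm, ⟨ha, -⟩ | ⟨ha, -⟩⟩ := hs
    · convert hypTerm_pred_powDvd hp2 (show m < p by omega) hr.neg ha using 1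
      ring
    · have := hypTerm_pred_powDvd hp2 (show m < p by omega) hr.neg ha
      have e : r - 1 = -1 - -r := by ring
      rw [e, hypTerm_symm] at this
      convert this using 1
      ring
  have h2 : PowDvd p 1 (p * ((p : ℚ) - 1)) :=
    PowDvd.self.mul_right ((PowDvd.nat p).sub .one)
  have hu' : IsPUnit p (p * (p - 1) + r * (1 - r)) :=
    IsPUnit.of_sub (by convert h2 using 1; ring) hu
  apply PowDvd.of_mul hu'
  convert h1.add (PowDvd.self.mul h2) using 1
  ring

theorem hypValue_powDvd {r s : ℚ} (hr : PowDvd p 0 r) (hs : IsHypSign p r s) :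
    PowDvd p 0 (hypValue p r s) := by
  have hs' : PowDvd p 0 s := by
    obtain ⟨m, -, ⟨-, rfl⟩ | ⟨-, rfl⟩⟩ := hs
    · exact PowDvd.one.neg.pow m
    · exact (PowDvd.one.neg.pow m).neg
  have hr2 : PowDvd p 0 (1 - 2 * r) := PowDvd.one.sub (PowDvd.two.mul hr)
  have h2 : PowDvd p 0 (1 / 2 : ℚ) := PowDvd.one.div (IsPUnit.of_prime Nat.prime_two hp2)
  exact (hs'.mul (hr2.pow 2)).add (((PowDvd.four.mul (.nat p)).mul
    (hr.mul (PowDvd.one.sub hr))).mul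
      (PowDvd.one.add ((h2.mul hr2).mul (eulerPolynomial_eval_powDvd hp2 _ hr))))

theorem padicIntCongr_hypSum {r s : ℚ} (hr : PowDvd p 0 r) (hs : IsHypSign p r s) :
    PadicIntCongr p 2 (hypSum (-r) p) (hypValue p r s) :=
  (hypSum_sub_hypValue_powDvd hp2 hr hs).padicIntCongr (hypValue_powDvd hp2 hr hs)

/-- `sum_hypTerm_div` at n = p-1, with a(a+1) = -r(1-r) and last term ≡ -p. -/
theorem padicIntCongr_sum_hypTerm_div {r s : ℚ} (hr : PowDvd p 0 r) (hs : IsHypSign p r s)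
    (hu : IsPUnit p (r * (1 - r))) :
    PadicIntCongr p 2 (∑ k ∈ range (p - 1), hypTerm (-r) k / (k + 1))
      ((1 + 2 * p - hypValue p r s) / (2 * (r * (1 - r)))) := by
  have hu2 : IsPUnit p (2 * (r * (1 - r))) := (IsPUnit.of_prime Nat.prime_two hp2).mul hu
  have hv := hypValue_powDvd hp2 hr hs
  refine PowDvd.padicIntCongr (PowDvd.of_mul hu2 ?_)
    (((PowDvd.one.add (PowDvd.two.mul (.nat p))).sub hv).div hu2)
  have h1 := hypSum_sub_hypValue_powDvd hp2 hr hs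
  have h2 := hypTerm_pred_add_self_powDvd hp2 hr hs hu
  have h3 := sum_hypTerm_div (-r) (p - 1)
  have h4 : hypSum (-r) p = hypSum (-r) (p - 1) + hypTerm (-r) (p - 1) := by
    rw [hypSum, hypSum, ← sum_range_succ, Nat.sub_add_cancel hp.out.one_le]
  rw [Nat.cast_sub hp.out.one_le] at h3
  have h5 := (h2.mul_left (PowDvd.two.mul ((PowDvd.nat p).sub .one))).sub
    (h1.add ((PowDvd.self.mul PowDvd.self).mul_left .two))
  convert h5 using 1
  rw [mul_sub, mul_div_cancel₀ _ hu2.ne_zero, h4]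
  push_cast at h3
  linear_combination -2 * h3

end

/-! ### Specialization to r = 1/4, 1/3, 1/6 and the Legendre symbols. -/

theorem hypTerm_neg_quarter (k : ℕ) :
    hypTerm (-(1 / 4)) k = ((4 * k).choose (2 * k) : ℚ) / 16 ^ k := by
  rw [Nat.cast_choose ℚ (by omega), show 4 * k - 2 * k = 2 * k by omega]
  induction k with
  | zero => simp [hypTerm]
  | succ k ih =>
    rw [hypTerm_succ, ih, show 4 * (k + 1) = 4 * k + 1 + 1 + 1 + 1 by ring,
      show 2 * (k + 1) = 2 * k + 1 + 1 by ring]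
    simp only [Nat.factorial_succ]
    have h1 := Nat.factorial_ne_zero (2 * k)
    have h2 : (k : ℚ) + 1 / 2 = (2 * k + 1) / 2 := by ring
    push_cast
    rw [h2]
    field_simp
    ring

theorem hypTerm_neg_third (k : ℕ) :
    hypTerm (-(1 / 3)) k = ((3 * k).choose k : ℚ) * (4 / 27) ^ k := by
  rw [Nat.cast_choose ℚ (by omega), show 3 * k - k = 2 * k by omega]
  induction k with
  | zero => simp [hypTerm]
  | succ k ih =>
    rw [hypTerm_succ, ih, show 3 * (k + 1) = 3 * k + 1 + 1 + 1 by ring,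
      show 2 * (k + 1) = 2 * k + 1 + 1 by ring]
    simp only [Nat.factorial_succ]
    have h1 := Nat.factorial_ne_zero (2 * k)
    have h3 := Nat.factorial_ne_zero k
    have h2 : (k : ℚ) + 1 / 2 = (2 * k + 1) / 2 := by ring
    push_cast
    rw [h2]
    field_simp
    ring

theorem hypTerm_neg_sixth (k : ℕ) :
    hypTerm (-(1 / 6)) k = ((6 * k).choose (3 * k) : ℚ) * ((3 * k).choose k : ℚ) /
      (108 ^ k * ((2 * k).choose k : ℚ)) := by
  rw [Nat.cast_choose ℚ (show 3 * k ≤ 6 * k by omega), Nat.cast_choose ℚ (show k ≤ 3 * k by omega),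
    Nat.cast_choose ℚ (show k ≤ 2 * k by omega), show 3 * k - k = 2 * k by omega,
    show 6 * k - 3 * k = 3 * k by omega, show 2 * k - k = k by omega]
  induction k with
  | zero => simp [hypTerm]
  | succ k ih =>
    rw [hypTerm_succ, ih, show 6 * (k + 1) = 6 * k + 1 + 1 + 1 + 1 + 1 + 1 by ring,
      show 3 * (k + 1) = 3 * k + 1 + 1 + 1 by ring, show 2 * (k + 1) = 2 * k + 1 + 1 by ring]
    simp only [Nat.factorial_succ]
    have h1 := Nat.factorial_ne_zero (2 * k)
    have h3 := Nat.factorial_ne_zero k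
    have h4 := Nat.factorial_ne_zero (3 * k)
    have h2 : (k : ℚ) + 1 / 2 = (2 * k + 1) / 2 := by ring
    push_cast
    rw [h2]
    field_simp
    ring

section

variable {p : ℕ} [hp : Fact p.Prime]

theorem isHypSign_quarter (hp2 : p ≠ 2) : IsHypSign p (1 / 4) (legendreSym p 2) := by
  have hodd := hp.out.eq_two_or_odd.resolve_left hp2
  have hl := legendreSym.at_two hp2
  rw [ZMod.χ₈_nat_eq_if_mod_eight] at hl
  have h4 : p % 4 = 1 ∨ p % 4 = 3 := by omega
  rcases h4 with h | h
  · refine ⟨p / 4, by omega, Or.inl ⟨?_, ?_⟩⟩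
    · have e : (p : ℚ) = 4 * (p / 4 : ℕ) + 1 := by exact_mod_cast (by omega : p = 4 * (p / 4) + 1)
      rw [e]
      linarith
    · rw [hl]
      rcases Nat.even_or_odd (p / 4) with h' | h'
      · rw [h'.neg_one_pow]
        have := Nat.even_iff.1 h'
        rw [if_neg (by omega), if_pos (by omega)]; simp
      · rw [h'.neg_one_pow]
        have := Nat.odd_iff.1 h'
        rw [if_neg (by omega), if_neg (by omega)]; simp
  · refine ⟨p / 4, by omega, Or.inr ⟨?_, ?_⟩⟩
    · have e : (p : ℚ) = 4 * (p / 4 : ℕ) + 3 := by exact_mod_cast (by omega : p = 4 * (p / 4) + 3)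
      rw [e]
      linarith
    · rw [hl]
      rcases Nat.even_or_odd (p / 4) with h' | h'
      · rw [h'.neg_one_pow]
        have := Nat.even_iff.1 h'
        rw [if_neg (by omega), if_neg (by omega)]; simp
      · rw [h'.neg_one_pow]
        have := Nat.odd_iff.1 h'
        rw [if_neg (by omega), if_pos (by omega)]; simp

theorem mod_three_ne_zero (hp3 : p ≠ 3) : p % 3 ≠ 0 := fun h =>
  hp3 ((Nat.prime_dvd_prime_iff_eq Nat.prime_three hp.out).1 (Nat.dvd_of_mod_eq_zero h)).symm

/-- No Legendre symbol appears: p being odd, ⌊p/3⌋ is even when p ≡ 1 and odd when p ≡ 2 modulo 3.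
-/
theorem isHypSign_third (hp2 : p ≠ 2) (hp3 : p ≠ 3) : IsHypSign p (1 / 3) 1 := by
  have hodd := hp.out.eq_two_or_odd.resolve_left hp2
  have h3 := mod_three_ne_zero hp3
  have h4 : p % 3 = 1 ∨ p % 3 = 2 := by omega
  rcases h4 with h | h
  · refine ⟨p / 3, by omega, Or.inl ⟨?_, ?_⟩⟩
    · have e : (p : ℚ) = 3 * (p / 3 : ℕ) + 1 := by exact_mod_cast (by omega : p = 3 * (p / 3) + 1)
      rw [e]
      linarith
    · rw [(Nat.even_iff.2 (by omega : p / 3 % 2 = 0)).neg_one_pow]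
  · refine ⟨p / 3, by omega, Or.inr ⟨?_, ?_⟩⟩
    · have e : (p : ℚ) = 3 * (p / 3 : ℕ) + 2 := by exact_mod_cast (by omega : p = 3 * (p / 3) + 2)
      rw [e]
      linarith
    · rw [(Nat.odd_iff.2 (by omega : p / 3 % 2 = 1)).neg_one_pow, neg_neg]

theorem isHypSign_sixth (hp2 : p ≠ 2) (hp3 : p ≠ 3) :
    IsHypSign p (1 / 6) (legendreSym p 3) := by
  have hodd := hp.out.eq_two_or_odd.resolve_left hp2
  have h3 := mod_three_ne_zero hp3
  have : Fact (Nat.Prime 3) := ⟨Nat.prime_three⟩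
  have hl : legendreSym p 3 = (-1) ^ (3 / 2 * (p / 2)) * legendreSym 3 p :=
    legendreSym.quadratic_reciprocity' (p := 3) (q := p) (by norm_num) hp2
  rw [legendreSym.mod 3] at hl
  have h4 : p % 6 = 1 ∨ p % 6 = 5 := by omega
  rcases h4 with h | h
  · refine ⟨p / 6, by omega, Or.inl ⟨?_, ?_⟩⟩
    · have e : (p : ℚ) = 6 * (p / 6 : ℕ) + 1 := by exact_mod_cast (by omega : p = 6 * (p / 6) + 1)
      rw [e]
      linarith
    · have e1 : (p : ℤ) % (3 : ℕ) = 1 := by omega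
      -- Natural division makes 3 / 2 = 1; the reciprocity exponent has the parity of m = ⌊p/6⌋.
      have e2 : 3 / 2 * (p / 2) = p / 6 + 2 * (p / 6) := by omega
      rw [e1, legendreSym.at_one, e2, pow_add, pow_mul] at hl
      rw [hl]; simp
  · refine ⟨p / 6, by omega, Or.inr ⟨?_, ?_⟩⟩
    · have e : (p : ℚ) = 6 * (p / 6 : ℕ) + 5 := by exact_mod_cast (by omega : p = 6 * (p / 6) + 5)
      rw [e]
      linarith
    · have e1 : (p : ℤ) % (3 : ℕ) = 2 := by omega
      have e2 : 3 / 2 * (p / 2) = p / 6 + 2 * (p / 6 + 1) := by omega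
      have e3 : legendreSym 3 2 = -1 := by rw [legendreSym.at_two (by norm_num)]; decide
      rw [e1, e3, e2, pow_add, pow_mul] at hl
      rw [hl]; simp

end

theorem corollary1p3 (p : ℕ) [Fact p.Prime] (hp : p ≠ 2) :
    PadicIntCongr p 2
      (∑ k ∈ Finset.range p, ((4 * k).choose (2 * k) : ℚ) / 16 ^ k)
      (1 / 4 * (legendreSym p 2 : ℚ) + 3 / 4 * (p : ℚ)
        + 3 / 16 * (p : ℚ) * (eulerPolynomial (p - 2)).eval (1 / 4)) ∧
    (3 < p →
      PadicIntCongr p 2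
        (∑ k ∈ Finset.range (p - 1),
          ((4 * k).choose (2 * k) : ℚ) / (((k : ℚ) + 1) * 16 ^ k))
        (8 / 3 - 2 / 3 * (legendreSym p 2 : ℚ) + 10 / 3 * (p : ℚ)
          - 1 / 2 * (p : ℚ) * (eulerPolynomial (p - 2)).eval (1 / 4)) ∧
      PadicIntCongr p 2
        (∑ k ∈ Finset.range p, ((3 * k).choose k : ℚ) * (4 / 27) ^ k)
        (1 / 9 + 8 / 9 * (p : ℚ)
          + 4 / 27 * (p : ℚ) * (eulerPolynomial (p - 2)).eval (1 / 3)) ∧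
      PadicIntCongr p 2
        (∑ k ∈ Finset.range (p - 1),
          ((3 * k).choose k : ℚ) / ((k : ℚ) + 1) * (4 / 27) ^ k)
        (2 + 5 / 2 * (p : ℚ)
          - 1 / 3 * (p : ℚ) * (eulerPolynomial (p - 2)).eval (1 / 3)) ∧
      PadicIntCongr p 2
        (∑ k ∈ Finset.range p,
          (((6 * k).choose (3 * k) : ℚ) * ((3 * k).choose k : ℚ))
            / (108 ^ k * ((2 * k).choose k : ℚ)))
        (4 / 9 * (legendreSym p 3 : ℚ) + 5 / 9 * (p : ℚ)
          + 5 / 27 * (p : ℚ) * (eulerPolynomial (p - 2)).eval (1 / 6))) ∧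
    (5 < p →
      PadicIntCongr p 2
        (∑ k ∈ Finset.range (p - 1),
          (((6 * k).choose (3 * k) : ℚ) * ((3 * k).choose k : ℚ))
            / (((k : ℚ) + 1) * 108 ^ k * ((2 * k).choose k : ℚ)))
        (18 / 5 - 8 / 5 * (legendreSym p 3 : ℚ) + 26 / 5 * (p : ℚ)
          - 2 / 3 * (p : ℚ) * (eulerPolynomial (p - 2)).eval (1 / 6))) := by
  have h2 : IsPUnit p 2 := IsPUnit.of_prime Nat.prime_two hp
  have h4 : IsPUnit p 4 := by simpa [show (2 : ℚ) * 2 = 4 by norm_num] using h2.mul h2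
  have hr4 : PowDvd p 0 (1 / 4) := PowDvd.one.div h4
  have hs4 := isHypSign_quarter hp
  refine ⟨?_, fun hp3 => ?_, fun hp5 => ?_⟩
  · convert padicIntCongr_hypSum hp hr4 hs4 using 1
    · exact sum_congr rfl fun k _ => (hypTerm_neg_quarter k).symm
    · rw [hypValue]; ring
  · have h3 : IsPUnit p 3 := IsPUnit.of_prime Nat.prime_three hp3.ne'
    have hr3 : PowDvd p 0 (1 / 3) := PowDvd.one.div h3
    have hs3 := isHypSign_third hp hp3.ne'
    have hr6 : PowDvd p 0 (1 / 6) := by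
      simpa [show (2 : ℚ) * 3 = 6 by norm_num] using PowDvd.one.div (h2.mul h3)
    have hs6 := isHypSign_sixth hp hp3.ne'
    refine ⟨?_, ?_, ?_, ?_⟩
    · have hu : IsPUnit p (1 / 4 * (1 - 1 / 4)) := by
        convert h3.div (h4.mul h4) using 1; norm_num
      convert padicIntCongr_sum_hypTerm_div hp hr4 hs4 hu using 1
      · refine sum_congr rfl fun k _ => ?_
        rw [hypTerm_neg_quarter, div_div, mul_comm (16 ^ k)]
      · rw [hypValue]; ring
    · convert padicIntCongr_hypSum hp hr3 hs3 using 1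
      · exact sum_congr rfl fun k _ => (hypTerm_neg_third k).symm
      · rw [hypValue]; ring
    · have hu : IsPUnit p (1 / 3 * (1 - 1 / 3)) := by
        convert h2.div (h3.mul h3) using 1; norm_num
      convert padicIntCongr_sum_hypTerm_div hp hr3 hs3 hu using 1
      · refine sum_congr rfl fun k _ => ?_
        rw [hypTerm_neg_third, div_mul_eq_mul_div]
      · rw [hypValue]; ring
    · convert padicIntCongr_hypSum hp hr6 hs6 using 1
      · exact sum_congr rfl fun k _ => (hypTerm_neg_sixth k).symm
      · rw [hypValue]; ring
  · have hp3 : p ≠ 3 := by omega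
    have h3 : IsPUnit p 3 := IsPUnit.of_prime Nat.prime_three hp3
    have h5 : IsPUnit p 5 := IsPUnit.of_prime Nat.prime_five hp5.ne'
    have h6 : IsPUnit p 6 := by simpa [show (2 : ℚ) * 3 = 6 by norm_num] using h2.mul h3
    have hu : IsPUnit p (1 / 6 * (1 - 1 / 6)) := by
      convert h5.div (h6.mul h6) using 1; norm_num
    convert padicIntCongr_sum_hypTerm_div hp (PowDvd.one.div h6) (isHypSign_sixth hp hp3) hu using 1
    · refine sum_congr rfl fun k _ => ?_
      rw [hypTerm_neg_sixth, div_div]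
      congr 1; ring
    · rw [hypValue]; ring
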